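/- Let $\mathbb{T}$ be the unit circle with normalized arc length $\frac{d\xi}{2\pi}$, let $L^2=L^2(\mathbb{T})$, let $H^2\subset L^2$ be the Hardy space of functions whose Fourier coefficients of negative order vanish, and let $H^\infty=H^2\cap L^\infty(\mathbb{T})$. For $\varphi\in L^2$ the Toeplitz operator $T_\varphi$ is defined on $H^\infty$ by $T_\varphi g=P_{H^2}(\varphi g)$, where $P_{H^2}$ is the orthogonal projection of $L^2$ onto $H^2$. For $\lambda$ in the open unit disc $\mathbb{D}$ put $b_\lambda(\xi)=\frac{\xi-\lambda}{1-\bar\lambda\xi}$, and for $n\in\mathbb{N}$ let $K_{b_\lambda^n}=H^2\cap(b_\lambda^nH^2)^\perp$ be the model space associated with $b_\lambda^n$. It is finite dimensional and contained in $H^\infty$. Let $T_{\varphi,K_{b_\lambda^n}}\colon K_{b_\lambda^n}\to K_{b_\lambda^n}$, $g\mapsto P_{K_{b_\lambda^n}}T_\varphi g$, be the compression of $T_\varphi$ to it. Denote by $\lambda_k(A)$ the eigenvalues (with algebraic multiplicity) and by $\sigma_k(A)$ the singular values of an operator $A$ on a finite dimensional space. Theorem. Let $\lambda\in\mathbb{D}$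 and let $f\in L^2$ be real valued. Then $T_f$ is distributed as $f\circ b_{-\lambda}$ in the sense of the eigenvalues relative to the sequence of model spaces $(K_{b_\lambda^n})_{n\in\mathbb{N}}$, that is, for every continuous function $G:\mathbb{C}\to\mathbb{C}$ with compact support, $$\lim_{n\to\infty}\frac{1}{\dim K_{b_\lambda^n}}\sum_{k=1}^{\dim K_{b_\lambda^n}}G\bigl(\lambda_k(T_{f,K_{b_\lambda^n}})\bigr)=\frac1{2\pi}\int_{\mathbb{T}}G\bigl((f\circ b_{-\lambda})(\xi)\bigr)\,d\xi ,$$ and $T_f$ is distributed as $|f\circ b_{-\lambda}|$ in the sense of the singular values relative to the same sequence, that is, for every continuous function $G:\mathbb{R}\to\mathbb{C}$ with compact support, $$\lim_{n\to\infty}\frac{1}{\dim K_{b_\lambda^n}}\sum_{k=1}^{\dim K_{b_\lambda^n}}G\bigl(\sigma_k(T_{f,K_{b_\lambda^n}})\bigr)=\frac1{2\pi}\int_{\mathbb{T}}G\bigl(|(f\circ b_{-\lambda})(\xi)|\bigr)\,d\xi .$$ -/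

import Mathlib

open MeasureTheory Filter Topology Complex.UnitDisc
open scoped ENNReal

noncomputable section

namespace ModelSpaces

/-- The unit circle carries its Borel sigma-algebra. -/
instance : MeasurableSpace Circle := borel Circle

instance : BorelSpace Circle := ⟨rfl⟩

/-- Normalized arc length `dξ / 2π` on the unit circle: the image of the normalized Haar measure
of `ℝ / 2πℤ` under `t ↦ exp (i t)`. -/
def circleMeasure : Measure Circle :=
  (@AddCircle.haarAddCircle (2 * Real.pi) ⟨Real.two_pi_pos⟩).map
    (AddCircle.toCircle : AddCircle (2 * Real.pi) → Circle)

instance : IsProbabilityMeasure circleMeasure :=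
  Measure.isProbabilityMeasure_map AddCircle.continuous_toCircle.measurable.aemeasurable

/-- The Hilbert space `L²` of the unit circle. -/
abbrev L2 : Type := Lp ℂ 2 circleMeasure

/-- The `n`-th Fourier coefficient of a function on the circle. -/
def circleCoeff (f : Circle → ℂ) (n : ℤ) : ℂ :=
  ∫ ξ, (ξ : ℂ) ^ (-n) * f ξ ∂circleMeasure

/-- The monomial `ξ ↦ ξ ^ n` as a continuous function on the circle. -/
def monomial (n : ℤ) : C(Circle, ℂ) :=
  ⟨fun ξ => ((ξ ^ n : Circle) : ℂ), continuous_subtype_val.comp (continuous_zpow n)⟩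

theorem inner_monomial (n : ℤ) (f : L2) :
    inner ℂ ((monomial n).toLp 2 circleMeasure ℂ) f = circleCoeff f n := by
  rw [L2.inner_def, circleCoeff]
  refine integral_congr_ae ?_
  filter_upwards [ContinuousMap.coeFn_toLp (p := 2) (𝕜 := ℂ) circleMeasure (monomial n)] with ξ hξ
  rw [hξ]
  simp [monomial, mul_comm, ← Circle.coe_inv_eq_conj]

/-- The Hardy space `H²`: the elements of `L²` whose Fourier coefficients of negative order
vanish. -/
def hardy : Submodule ℂ L2 where
  carrier := {f | ∀ n : ℤ, n < 0 → circleCoeff f n = 0}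
  zero_mem' := by
    intro n _
    rw [← inner_monomial, inner_zero_right]
  add_mem' := by
    intro f g hf hg n hn
    rw [← inner_monomial, inner_add_right, inner_monomial, inner_monomial, hf n hn, hg n hn,
      add_zero]
  smul_mem' := by
    intro c f hf n hn
    rw [← inner_monomial, inner_smul_right, inner_monomial, hf n hn, mul_zero]

theorem isClosed_hardy : IsClosed (hardy : Set L2) := by
  have h : (hardy : Set L2) = ⋂ n : ℤ, ⋂ _ : n < 0,
      {f : L2 | inner ℂ ((monomial n).toLp 2 circleMeasure ℂ) f = 0} := by
    ext f
    simp [hardy, inner_monomial]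
  rw [h]
  exact isClosed_iInter fun n => isClosed_iInter fun _ =>
    isClosed_eq (continuous_const.inner continuous_id) continuous_const

instance : CompleteSpace hardy := isClosed_hardy.completeSpace_coe

/-- `H^∞`, the space of essentially bounded elements of `H²`. -/
def hardyInf : Submodule ℂ L2 where
  carrier := {f | f ∈ hardy ∧ MemLp f ∞ circleMeasure}
  zero_mem' := ⟨hardy.zero_mem, MemLp.zero.ae_eq (Lp.coeFn_zero ℂ 2 circleMeasure).symm⟩
  add_mem' := fun {f g} hf hg =>
    ⟨hardy.add_mem hf.1 hg.1, (hf.2.add hg.2).ae_eq (Lp.coeFn_add f g).symm⟩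
  smul_mem' := fun c f hf =>
    ⟨hardy.smul_mem c hf.1, (hf.2.const_smul c).ae_eq (Lp.coeFn_smul c f).symm⟩

theorem memLp_mul (φ : L2) (g : hardyInf) :
    MemLp (fun ξ => φ ξ * (g : L2) ξ) 2 circleMeasure :=
  MemLp.mul (p := 2) (q := ∞) (r := 2) g.2.2 (Lp.memLp φ)

/-- The Toeplitz operator `T_φ` with symbol `φ ∈ L²`, defined on `H^∞` with values in `H²`:
`T_φ g` is the orthogonal projection of `φ g ∈ L²` onto `H²`. -/
def toeplitz (φ : L2) : hardyInf →ₗ[ℂ] hardy :=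
  hardy.orthogonalProjectionOnto.toLinearMap ∘ₗ
    { toFun := fun g => (memLp_mul φ g).toLp _
      map_add' := by
        intro g h
        rw [← MemLp.toLp_add]
        refine MemLp.toLp_congr _ _ ?_
        filter_upwards [Lp.coeFn_add (g : L2) (h : L2)] with ξ hξ
        simp only [Submodule.coe_add, hξ, Pi.add_apply, mul_add]
      map_smul' := by
        intro c g
        rw [RingHom.id_apply, ← MemLp.toLp_const_smul]
        refine MemLp.toLp_congr _ _ ?_
        filter_upwards [Lp.coeFn_smul c (g : L2)] with ξ hξ
        simp only [Submodule.coe_smul, hξ, Pi.smul_apply, smul_eq_mul]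
        ring }

/-- The space `θ H²` of the products `θ h` with `h ∈ H²`, for a unimodular function `θ` on the
circle. -/
def mulHardy (θ : Circle → Circle) : Submodule ℂ L2 where
  carrier := {f | ∃ h ∈ hardy, ∀ᵐ ξ ∂circleMeasure, f ξ = (θ ξ : ℂ) * h ξ}
  zero_mem' := ⟨0, hardy.zero_mem, by
    filter_upwards with ξ
    simp⟩
  add_mem' := by
    rintro f g ⟨h, hh, hf⟩ ⟨k, hk, hg⟩
    refine ⟨h + k, hardy.add_mem hh hk, ?_⟩
    filter_upwards [hf, hg, Lp.coeFn_add f g, Lp.coeFn_add h k] with ξ h1 h2 h3 h4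
    rw [h3, h4, Pi.add_apply, Pi.add_apply, h1, h2, mul_add]
  smul_mem' := by
    rintro c f ⟨h, hh, hf⟩
    refine ⟨c • h, hardy.smul_mem c hh, ?_⟩
    filter_upwards [hf, Lp.coeFn_smul c f, Lp.coeFn_smul c h] with ξ h1 h2 h3
    rw [h2, h3, Pi.smul_apply, Pi.smul_apply, h1, smul_eq_mul, smul_eq_mul]
    ring

/-- The model space `K_θ = H² ⊖ θ H²`. -/
def modelSpace (θ : Circle → Circle) : Submodule ℂ L2 :=
  hardy ⊓ (mulHardy θ)ᗮ

theorem isClosed_modelSpace (θ : Circle → Circle) : IsClosed (modelSpace θ : Set L2) :=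
  isClosed_hardy.inter (mulHardy θ).isClosed_orthogonal

instance (θ : Circle → Circle) : CompleteSpace (modelSpace θ) :=
  (isClosed_modelSpace θ).completeSpace_coe

/-- The compression `T_{φ, K_θ}` of the Toeplitz operator `T_φ` to the model space `K_θ`, that is
`g ↦ P_{K_θ} (T_φ g)` on `K_θ`, where `K_θ` is contained in the domain `H^∞` of `T_φ`. -/
def compression (φ : L2) (θ : Circle → Circle) (hθ : modelSpace θ ≤ hardyInf) :
    modelSpace θ →ₗ[ℂ] modelSpace θ :=
  (modelSpace θ).orthogonalProjectionOnto.toLinearMap ∘ₗ hardy.subtype ∘ₗ toeplitz φ ∘ₗ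
    Submodule.inclusion hθ

/-- `T_φ` is distributed as `g` in the sense of the eigenvalues relative to the model spaces
`K_{B^n}`: these are finite dimensional and contained in `H^∞`, so that the compressions of `T_φ`
are defined, and the means of the values of `G` at the eigenvalues of these compressions, counted
with algebraic multiplicity, converge to the mean of `G ∘ g`, for all continuous `G` with compact
support. -/
def IsDistributedEigenvalues (φ : L2) (g : Circle → ℂ) (B : Circle → Circle) : Prop :=
  AEMeasurable g circleMeasure ∧
  ∃ (_ : ∀ n : ℕ, FiniteDimensional ℂ (modelSpace (B ^ n)))
    (hB : ∀ n : ℕ, modelSpace (B ^ n) ≤ hardyInf),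
    ∀ G : ℂ → ℂ, Continuous G → HasCompactSupport G →
      Tendsto
        (fun n : ℕ => ((Module.finrank ℂ (modelSpace (B ^ n)) : ℂ))⁻¹ *
          ((compression φ (B ^ n) (hB n)).charpoly.roots.map G).sum)
        atTop (𝓝 (∫ ξ, G (g ξ) ∂circleMeasure))

/-- `T_φ` is distributed as `g` in the sense of the singular values relative to the model spaces
`K_{B^n}`: the same with the singular values of the compressions, as many as the dimension. -/
def IsDistributedSingularValues (φ : L2) (g : Circle → ℝ) (B : Circle → Circle) : Prop :=
  AEMeasurable g circleMeasure ∧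
  ∃ (_ : ∀ n : ℕ, FiniteDimensional ℂ (modelSpace (B ^ n)))
    (hB : ∀ n : ℕ, modelSpace (B ^ n) ≤ hardyInf),
    ∀ G : ℝ → ℂ, Continuous G → HasCompactSupport G →
      Tendsto
        (fun n : ℕ => ((Module.finrank ℂ (modelSpace (B ^ n)) : ℂ))⁻¹ *
          ∑ k ∈ Finset.range (Module.finrank ℂ (modelSpace (B ^ n))),
            G ((compression φ (B ^ n) (hB n)).singularValues k))
        atTop (𝓝 (∫ ξ, G (g ξ) ∂circleMeasure))

theorem norm_blaschke (a : 𝔻) (ξ : Circle) :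
    ‖((ξ : ℂ) - a) / (1 - (starRingEnd ℂ) (a : ℂ) * ξ)‖ = 1 := by
  have h : (1 : ℂ) - (starRingEnd ℂ) (a : ℂ) * ξ = ξ * (starRingEnd ℂ) ((ξ : ℂ) - a) := by
    rw [map_sub, mul_sub, Complex.mul_conj, Circle.normSq_coe]
    push_cast
    ring
  have h0 : (ξ : ℂ) - a ≠ 0 := by
    intro h1
    apply a.norm_ne_one
    rw [← sub_eq_zero.mp h1, Circle.norm_coe]
  rw [h, norm_div, norm_mul, Circle.norm_coe, one_mul, RCLike.norm_conj,
    div_self (norm_ne_zero_iff.mpr h0)]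

/-- The Blaschke factor `b_a(ξ) = (ξ - a) / (1 - conj a * ξ)`, for `a` in the open unit disc, as a
map of the unit circle to itself. -/
def blaschke (a : 𝔻) (ξ : Circle) : Circle :=
  ⟨((ξ : ℂ) - a) / (1 - (starRingEnd ℂ) (a : ℂ) * ξ),
    mem_sphere_zero_iff_norm.mpr (norm_blaschke a ξ)⟩

end ModelSpaces

end

open scoped ComplexConjugate

noncomputable section

namespace ModelSpaces

/-! In the orthonormal Takenaka–Malmquist basis `√(1-|a|²) k_a b_a^k`, `k < n`, where `k_a` is the
Szegő kernel, the compression of `T_f` is the n × n Toeplitz matrix of `f ∘ b_{-a}`: the product of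
one basis function with the conjugate of another is `P_a b_a^(k-j)`, and `b_a` carries the harmonic
measure `P_a dξ/2π` to arc length (`inner_takenakaBasis_compression`).

What remains is Szegő's theorem for a real square integrable symbol, proved by a variance estimate.
Let `v_i` be unit eigenvectors with eigenvalues `λ_i`. Then `λ_i` is the mean of `f` under the
probability density `|v_i|²`, and these densities add up to `n P_a`
(`sum_norm_sq_orthonormalBasis`). Hence `∑ H(λ_i) - n ∫ P_a H(f)` is controlled by the sum of the
variances, `n ∫ P_a f² - ∑ λ_i²` (`norm_sum_sub_integral_le`). This is o(n): `∑ λ_i²` is the squared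
Hilbert–Schmidt norm of the Toeplitz matrix, and by Parseval and Cesàro its quotient by n tends to
`∫ P_a f²` (`tendsto_mean_sq_compressionEigenvalues`). The compression is symmetric, so its singular
values are the `|λ_i|`, and the second claim is the first limit with `H = G ∘ |·|`. -/

/-! ### Fourier coefficients on the circle -/

theorem circleCoeff_congr_ae {f g : Circle → ℂ} (h : f =ᵐ[circleMeasure] g) (n : ℤ) :
    circleCoeff f n = circleCoeff g n := by
  refine integral_congr_ae ?_
  filter_upwards [h] with ξ hξ
  rw [hξ]

theorem circleCoeff_coe_mul (g : Circle → ℂ) (n : ℤ) :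
    circleCoeff (fun ξ => (ξ : ℂ) * g ξ) n = circleCoeff g (n - 1) := by
  refine integral_congr_ae (Eventually.of_forall fun ξ => ?_)
  have : (ξ : ℂ) ≠ 0 := ξ.coe_ne_zero
  change (ξ : ℂ) ^ (-n) * (ξ * g ξ) = (ξ : ℂ) ^ (-(n - 1)) * g ξ
  rw [← mul_assoc, ← zpow_add_one₀ this]
  congr 2
  ring

theorem continuous_circle_coe : Continuous fun ξ : Circle => (ξ : ℂ) :=
  continuous_subtype_val

theorem continuous_coe_zpow (n : ℤ) : Continuous fun ξ : Circle => (ξ : ℂ) ^ n :=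
  (monomial n).continuous.congr fun ξ => by simp [monomial]

theorem norm_coe_zpow (ξ : Circle) (n : ℤ) : ‖(ξ : ℂ) ^ n‖ = 1 := by
  rw [norm_zpow, Circle.norm_coe, one_zpow]

theorem integrable_continuous {u : Circle → ℂ} (hu : Continuous u) :
    Integrable u circleMeasure :=
  hu.integrable_of_hasCompactSupport (HasCompactSupport.of_compactSpace u)

theorem exists_norm_le_of_continuous {u : Circle → ℂ} (hu : Continuous u) :
    ∃ C, ∀ ξ, ‖u ξ‖ ≤ C := by
  obtain ⟨C, hC⟩ := isCompact_univ.exists_bound_of_continuousOn hu.continuousOn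
  exact ⟨C, fun ξ => hC ξ trivial⟩

theorem integrable_continuous_mul {u g : Circle → ℂ} (hu : Continuous u)
    (hg : Integrable g circleMeasure) : Integrable (fun ξ => u ξ * g ξ) circleMeasure := by
  obtain ⟨C, hC⟩ := exists_norm_le_of_continuous hu
  exact hg.bdd_mul hu.aestronglyMeasurable (Eventually.of_forall hC)

theorem circleCoeff_sub {f g : Circle → ℂ} (hf : Integrable f circleMeasure)
    (hg : Integrable g circleMeasure) (n : ℤ) :
    circleCoeff (fun ξ => f ξ - g ξ) n = circleCoeff f n - circleCoeff g n := by
  simp only [circleCoeff, mul_sub]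
  exact integral_sub (integrable_continuous_mul (continuous_coe_zpow _) hf)
    (integrable_continuous_mul (continuous_coe_zpow _) hg)

theorem circleCoeff_const_mul (c : ℂ) (g : Circle → ℂ) (n : ℤ) :
    circleCoeff (fun ξ => c * g ξ) n = c * circleCoeff g n := by
  simp only [circleCoeff, ← integral_const_mul]
  exact integral_congr_ae (Eventually.of_forall fun ξ => by ring)

theorem circleCoeff_neg_one (g : Circle → ℂ) :
    circleCoeff g (-1) = ∫ ξ, ξ * g ξ ∂circleMeasure := by
  simp [circleCoeff]

theorem norm_circleCoeff_le (g : Circle → ℂ) (n : ℤ) :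
    ‖circleCoeff g n‖ ≤ ∫ ξ, ‖g ξ‖ ∂circleMeasure := by
  refine (norm_integral_le_integral_norm _).trans_eq
    (integral_congr_ae (Eventually.of_forall fun ξ => ?_))
  simp only [norm_mul, norm_coe_zpow, one_mul]

instance fact_two_pi_pos : Fact (0 < 2 * Real.pi) := ⟨Real.two_pi_pos⟩

theorem integral_circleMeasure (g : Circle → ℂ) :
    ∫ ξ, g ξ ∂circleMeasure =
      ∫ t : AddCircle (2 * Real.pi), g (AddCircle.toCircle t)
        ∂AddCircle.haarAddCircle := by
  have h : MeasurableEmbedding (AddCircle.toCircle : AddCircle (2 * Real.pi) → Circle) :=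
    ((AddCircle.continuous_toCircle (T := 2 * Real.pi)).isClosedEmbedding
      (AddCircle.injective_toCircle Real.two_pi_pos.ne')).measurableEmbedding
  exact h.integral_map _

theorem circleCoeff_eq_fourierCoeff (g : Circle → ℂ) (n : ℤ) :
    circleCoeff g n = fourierCoeff
      (fun t : AddCircle (2 * Real.pi) => g (AddCircle.toCircle t)) n := by
  rw [circleCoeff, integral_circleMeasure, fourierCoeff]
  simp only [fourier_apply, AddCircle.toCircle_zsmul, Circle.coe_zpow, smul_eq_mul]

theorem circleCoeff_one (n : ℤ) : circleCoeff (fun _ => 1) n = if n = 0 then 1 else 0 := by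
  have h := fourierCoeff_fourier (T := 2 * Real.pi) 0
  rw [circleCoeff_eq_fourierCoeff]
  have h2 : (fun t : AddCircle (2 * Real.pi) => (1 : ℂ)) = fourier 0 := by
    ext t; simp
  rw [h2, h, Pi.single_apply]

/-! ### Analytic functions, Szegő kernels and division by Blaschke factors -/

/-- An integrable function on the circle whose Fourier coefficients of negative order vanish. -/
structure IsAnalytic (g : Circle → ℂ) : Prop where
  integrable : Integrable g circleMeasure
  coeff : ∀ n : ℤ, n < 0 → circleCoeff g n = 0

theorem isAnalytic_one : IsAnalytic fun _ => 1 :=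
  ⟨integrable_const _, fun n hn => by rw [circleCoeff_one, if_neg hn.ne]⟩

variable {g : Circle → ℂ}

theorem IsAnalytic.coe_mul (hg : IsAnalytic g) : IsAnalytic fun ξ => (ξ : ℂ) * g ξ :=
  ⟨integrable_continuous_mul continuous_circle_coe hg.integrable, fun n hn => by
    rw [circleCoeff_coe_mul, hg.coeff _ (by omega)]⟩

theorem IsAnalytic.const_mul (hg : IsAnalytic g) (c : ℂ) : IsAnalytic fun ξ => c * g ξ :=
  ⟨hg.integrable.const_mul c, fun n hn => by
    rw [circleCoeff_const_mul, hg.coeff _ hn, mul_zero]⟩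

theorem IsAnalytic.sub {f : Circle → ℂ} (hf : IsAnalytic f) (hg : IsAnalytic g) :
    IsAnalytic fun ξ => f ξ - g ξ :=
  ⟨hf.integrable.sub hg.integrable, fun n hn => by
    rw [circleCoeff_sub hf.integrable hg.integrable, hf.coeff _ hn, hg.coeff _ hn, sub_zero]⟩

theorem IsAnalytic.integral_coe_mul (hg : IsAnalytic g) :
    ∫ ξ, ξ * g ξ ∂circleMeasure = 0 := by
  rw [← circleCoeff_neg_one, hg.coeff _ (by norm_num)]

/-- The unnormalized Szegő kernel `1 / (1 - conj a * ξ)`. -/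
def szegoKernel (a : 𝔻) (ξ : Circle) : ℂ := (1 - conj (a : ℂ) * ξ)⁻¹

theorem one_sub_conj_mul_ne_zero (a : 𝔻) (ξ : Circle) : (1 : ℂ) - conj (a : ℂ) * ξ ≠ 0 := by
  intro h
  have h1 : ‖conj (a : ℂ) * ξ‖ = 1 := by rw [← sub_eq_zero.mp h, norm_one]
  rw [norm_mul, Circle.norm_coe, mul_one, RCLike.norm_conj] at h1
  exact a.norm_ne_one h1

theorem continuous_szegoKernel (a : 𝔻) : Continuous (szegoKernel a) :=
  (continuous_const.sub (continuous_const.mul continuous_circle_coe)).inv₀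
    (one_sub_conj_mul_ne_zero a)

theorem coe_blaschke (a : 𝔻) (ξ : Circle) :
    (blaschke a ξ : ℂ) = (ξ - a) * szegoKernel a ξ := by
  rw [szegoKernel, ← div_eq_mul_inv]
  rfl

theorem continuous_blaschke (a : 𝔻) : Continuous (blaschke a) := by
  refine Continuous.subtype_mk ?_ _
  exact (continuous_circle_coe.sub continuous_const).div
    (continuous_const.sub (continuous_const.mul continuous_circle_coe))
    (one_sub_conj_mul_ne_zero a)

theorem szegoKernel_mul_one_sub (a : 𝔻) (ξ : Circle) :
    szegoKernel a ξ * (1 - conj (a : ℂ) * ξ) = 1 :=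
  inv_mul_cancel₀ (one_sub_conj_mul_ne_zero a ξ)

theorem conj_szegoKernel_mul_one_sub (a : 𝔻) (ξ : Circle) :
    conj (szegoKernel a ξ) * (1 - a * conj (ξ : ℂ)) = 1 := by
  simpa using congrArg conj (szegoKernel_mul_one_sub a ξ)

theorem szegoKernel_eq (a : 𝔻) (ξ : Circle) :
    szegoKernel a ξ = 1 + conj (a : ℂ) * (ξ * szegoKernel a ξ) := by
  have := one_sub_conj_mul_ne_zero a ξ
  rw [szegoKernel]
  field_simp
  ring

theorem conj_coe_mul_coe (ξ : Circle) : conj (ξ : ℂ) * ξ = 1 := by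
  rw [mul_comm, Complex.mul_conj, Circle.normSq_coe, Complex.ofReal_one]

/-- On the circle the conjugate of the Szegő kernel is `ξ / (ξ - a)`, whose pole the Blaschke factor
cancels. What is left is analytic and vanishes at the origin, which is the source of all the
orthogonality relations below. -/
theorem conj_szegoKernel_mul_blaschke (a : 𝔻) (ξ : Circle) :
    conj (szegoKernel a ξ) * blaschke a ξ = ξ * szegoKernel a ξ := by
  rw [coe_blaschke]
  linear_combination (ξ * szegoKernel a ξ : ℂ) * conj_szegoKernel_mul_one_sub a ξ +
    conj (szegoKernel a ξ) * a * szegoKernel a ξ * conj_coe_mul_coe ξ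

/-- Multiplication by the Szegő kernel preserves analyticity: the negative coefficients of
`k g` are multiples by arbitrarily high powers of `conj a` of bounded quantities. -/
theorem IsAnalytic.szegoKernel_mul (hg : IsAnalytic g) (a : 𝔻) :
    IsAnalytic fun ξ => szegoKernel a ξ * g ξ := by
  have hi := integrable_continuous_mul (continuous_szegoKernel a) hg.integrable
  refine ⟨hi, ?_⟩
  set v : Circle → ℂ := fun ξ => szegoKernel a ξ * g ξ with hv
  have hgv : g = fun ξ => v ξ - conj (a : ℂ) * (ξ * v ξ) := by
    ext ξ
    have := one_sub_conj_mul_ne_zero a ξ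
    simp only [hv, szegoKernel]
    field_simp
  have hrec : ∀ n : ℤ, n < 0 → circleCoeff v n = conj (a : ℂ) * circleCoeff v (n - 1) := by
    intro n hn
    have h := hg.coeff n hn
    rw [hgv, circleCoeff_sub hi
      ((integrable_continuous_mul continuous_circle_coe hi).const_mul _),
      circleCoeff_const_mul, circleCoeff_coe_mul] at h
    exact sub_eq_zero.mp h
  have hpow : ∀ (k : ℕ) (n : ℤ), n < 0 →
      circleCoeff v n = conj (a : ℂ) ^ k * circleCoeff v (n - k) := by
    intro k
    induction k with
    | zero => intro n _; simp
    | succ k ih =>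
      intro n hn
      rw [ih n hn, hrec (n - k) (by omega), pow_succ, mul_assoc]
      congr 3
      push_cast
      ring
  intro n hn
  have hb : ∀ k : ℕ, ‖circleCoeff v n‖ ≤ ‖(a : ℂ)‖ ^ k * ∫ ξ, ‖v ξ‖ ∂circleMeasure := by
    intro k
    rw [hpow k n hn, norm_mul, norm_pow, RCLike.norm_conj]
    gcongr
    exact norm_circleCoeff_le _ _
  have hlim : Tendsto (fun k : ℕ => ‖(a : ℂ)‖ ^ k * ∫ ξ, ‖v ξ‖ ∂circleMeasure) atTop (𝓝 0) := by
    simpa using (tendsto_pow_atTop_nhds_zero_of_lt_one (norm_nonneg _)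
      a.norm_lt_one).mul_const (∫ ξ, ‖v ξ‖ ∂circleMeasure)
  exact norm_le_zero_iff.mp (ge_of_tendsto' hlim hb)

theorem IsAnalytic.blaschke_mul (hg : IsAnalytic g) (a : 𝔻) :
    IsAnalytic fun ξ => (blaschke a ξ : ℂ) * g ξ := by
  have h := (hg.szegoKernel_mul a).coe_mul.sub ((hg.szegoKernel_mul a).const_mul a)
  convert h using 2 with ξ
  rw [coe_blaschke]
  ring

theorem IsAnalytic.blaschke_pow_mul (hg : IsAnalytic g) (a : 𝔻) (k : ℕ) :
    IsAnalytic fun ξ => (blaschke a ξ : ℂ) ^ k * g ξ := by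
  induction k with
  | zero => simpa using hg
  | succ k ih =>
    convert ih.blaschke_mul a using 2 with ξ
    ring

theorem IsAnalytic.integral_conj_szegoKernel_mul (hg : IsAnalytic g) (a : 𝔻) (k : ℕ) :
    ∫ ξ, conj (szegoKernel a ξ) * ((blaschke a ξ : ℂ) ^ (k + 1) * g ξ) ∂circleMeasure = 0 := by
  rw [← ((hg.blaschke_pow_mul a k).szegoKernel_mul a).integral_coe_mul]
  refine integral_congr_ae (Eventually.of_forall fun ξ => ?_)
  simp only [← mul_assoc, ← conj_szegoKernel_mul_blaschke, pow_succ]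
  ring

/-- An analytic function which is orthogonal to the Szegő kernel is divisible by the Blaschke
factor. -/
theorem IsAnalytic.conj_blaschke_mul (hg : IsAnalytic g) (a : 𝔻)
    (h : ∫ ξ, conj (szegoKernel a ξ) * g ξ ∂circleMeasure = 0) :
    IsAnalytic fun ξ => conj (blaschke a ξ : ℂ) * g ξ := by
  set u : Circle → ℂ := fun ξ => conj (blaschke a ξ : ℂ) * g ξ with hu
  have hi : Integrable u circleMeasure := integrable_continuous_mul
    (Complex.continuous_conj.comp (continuous_circle_coe.comp (continuous_blaschke a)))
    hg.integrable
  have hk := integrable_continuous_mul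
    (Complex.continuous_conj.comp (continuous_szegoKernel a)) hg.integrable
  simp only [Function.comp_apply] at hk
  have hxi := integrable_continuous_mul continuous_circle_coe hg.integrable
  -- This writes the coefficient of order -1 of `u` through the two integrals known to vanish: the
  -- one in `h` and `∫ ξ g`.
  have hx : ∀ ξ : Circle, ξ * conj (blaschke a ξ : ℂ) =
      (1 - conj (a : ℂ) * a) * conj (szegoKernel a ξ) - conj (a : ℂ) * ξ := by
    intro ξ
    rw [coe_blaschke, map_mul, map_sub]
    linear_combination (1 - conj (a : ℂ) * a) * conj (szegoKernel a ξ) * conj_coe_mul_coe ξ -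
      conj (a : ℂ) * ξ * conj_szegoKernel_mul_one_sub a ξ
  have hneg : circleCoeff u (-1) = 0 := by
    rw [circleCoeff_neg_one]
    have : ∀ ξ : Circle, ξ * u ξ = (1 - conj (a : ℂ) * a) * (conj (szegoKernel a ξ) * g ξ)
        - conj (a : ℂ) * (ξ * g ξ) := by
      intro ξ
      rw [hu, ← mul_assoc, hx]
      ring
    simp only [this]
    rw [integral_sub (hk.const_mul _) (hxi.const_mul _), integral_const_mul, integral_const_mul,
      hg.integral_coe_mul, h]
    simp
  -- Since `(ξ - a) u = (1 - conj a ξ) g` is analytic, the vanishing at order -1 propagates to all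
  -- lower orders.
  have hrec : ∀ n : ℤ, n < 0 → circleCoeff u (n - 1) = a * circleCoeff u n := by
    intro n hn
    have h3 := (hg.sub (hg.coe_mul.const_mul (conj (a : ℂ)))).coeff n hn
    have h4 : (fun ξ : Circle => g ξ - conj (a : ℂ) * (ξ * g ξ)) =
        fun ξ => ξ * u ξ - a * u ξ := by
      ext ξ
      have h1 := one_sub_conj_mul_ne_zero a ξ
      have hb := conj_coe_mul_coe (blaschke a ξ)
      have hb2 : (ξ : ℂ) - a = blaschke a ξ * (1 - conj (a : ℂ) * ξ) := by
        rw [coe_blaschke, szegoKernel, inv_mul_cancel_right₀ h1]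
      rw [← sub_mul, hb2, hu]
      linear_combination (-(1 - conj (a : ℂ) * ξ) * g ξ) * hb
    rw [h4, circleCoeff_sub (integrable_continuous_mul continuous_circle_coe hi)
      (hi.const_mul _), circleCoeff_const_mul, circleCoeff_coe_mul] at h3
    exact sub_eq_zero.mp h3
  refine ⟨hi, fun n hn => ?_⟩
  have key : ∀ k : ℕ, circleCoeff u (-1 - k) = 0 := by
    intro k
    induction k with
    | zero => simpa using hneg
    | succ k ih =>
      have := hrec (-1 - k) (by omega)
      rw [ih, mul_zero] at this
      rw [← this]
      congr 1
      push_cast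
      ring
  obtain ⟨k, rfl⟩ : ∃ k : ℕ, n = -1 - k := ⟨(-1 - n).toNat, by omega⟩
  exact key k

/-- Substituting `k = 1 + conj a ξ k` in both factors, the cross terms integrate to zero and the
integral `I` satisfies `I = 1 + |a|² I`. -/
theorem norm_sq_integral_szegoKernel (a : 𝔻) :
    (1 - conj (a : ℂ) * a) * ∫ ξ, conj (szegoKernel a ξ) * szegoKernel a ξ ∂circleMeasure = 1 := by
  have hk := continuous_szegoKernel a
  have hc : Continuous fun ξ : Circle => conj (szegoKernel a ξ) := Complex.continuous_conj.comp hk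
  have han : IsAnalytic fun ξ => szegoKernel a ξ * 1 := isAnalytic_one.szegoKernel_mul a
  simp only [mul_one] at han
  have hint : Integrable (fun ξ => conj (szegoKernel a ξ) * szegoKernel a ξ) circleMeasure :=
    integrable_continuous (hc.mul hk)
  have hsplit : ∀ ξ : Circle, conj (szegoKernel a ξ) * szegoKernel a ξ =
      1 + conj (a : ℂ) * (ξ * szegoKernel a ξ) + a * conj ((ξ : ℂ) * szegoKernel a ξ)
        + conj (a : ℂ) * a * (conj (szegoKernel a ξ) * szegoKernel a ξ) := by
    intro ξ
    have h1 := szegoKernel_eq a ξ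
    have h2 := congrArg conj h1
    simp only [map_add, map_one, map_mul, Complex.conj_conj] at h2
    rw [map_mul]
    linear_combination (1 + conj (a : ℂ) * (ξ * szegoKernel a ξ)) * h2 + conj (szegoKernel a ξ) * h1
      + conj (a : ℂ) * a * (conj (szegoKernel a ξ) * szegoKernel a ξ) * conj_coe_mul_coe ξ
  have hz : ∫ ξ : Circle, (ξ : ℂ) * szegoKernel a ξ ∂circleMeasure = 0 := han.integral_coe_mul
  have hcz : ∫ ξ : Circle, conj ((ξ : ℂ) * szegoKernel a ξ) ∂circleMeasure = 0 := by
    rw [integral_conj, hz, map_zero]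
  have hxi : Integrable (fun ξ : Circle => (ξ : ℂ) * szegoKernel a ξ) circleMeasure :=
    integrable_continuous (continuous_circle_coe.mul hk)
  have hxc : Integrable (fun ξ : Circle => conj ((ξ : ℂ) * szegoKernel a ξ)) circleMeasure :=
    integrable_continuous (Complex.continuous_conj.comp (continuous_circle_coe.mul hk))
  have h : ∫ ξ, conj (szegoKernel a ξ) * szegoKernel a ξ ∂circleMeasure =
      1 + conj (a : ℂ) * 0 + a * 0
        + conj (a : ℂ) * a * ∫ ξ, conj (szegoKernel a ξ) * szegoKernel a ξ ∂circleMeasure := by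
    have h1 : Integrable (fun _ : Circle => (1 : ℂ)) circleMeasure := integrable_const _
    have h2 : Integrable (fun ξ : Circle => 1 + conj (a : ℂ) * (ξ * szegoKernel a ξ))
      circleMeasure := h1.add (hxi.const_mul _)
    have h3 : Integrable (fun ξ : Circle => 1 + conj (a : ℂ) * (ξ * szegoKernel a ξ)
      + a * conj ((ξ : ℂ) * szegoKernel a ξ)) circleMeasure := h2.add (hxc.const_mul _)
    refine (integral_congr_ae (Eventually.of_forall hsplit)).trans ?_
    rw [integral_add h3 (hint.const_mul _),
      integral_add h2 (hxc.const_mul _), integral_add h1 (hxi.const_mul _)]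
    simp only [integral_const_mul, hz, hcz, integral_const, probReal_univ, one_smul]
  linear_combination h

/-! ### Harmonic measure and the change of variables by the Blaschke factor -/

/-- The Poisson kernel `(1 - |a|²) / |1 - conj a * ξ|²`. -/
def poissonKernel (a : 𝔻) (ξ : Circle) : ℝ := (1 - ‖(a : ℂ)‖ ^ 2) * ‖szegoKernel a ξ‖ ^ 2

theorem continuous_poissonKernel (a : 𝔻) : Continuous (poissonKernel a) :=
  continuous_const.mul ((continuous_szegoKernel a).norm.pow 2)

theorem one_sub_norm_sq_pos (a : 𝔻) : 0 < 1 - ‖(a : ℂ)‖ ^ 2 := by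
  have := a.norm_lt_one
  nlinarith [norm_nonneg (a : ℂ)]

theorem poissonKernel_nonneg (a : 𝔻) (ξ : Circle) : 0 ≤ poissonKernel a ξ :=
  mul_nonneg (one_sub_norm_sq_pos a).le (sq_nonneg _)

theorem coe_poissonKernel (a : 𝔻) (ξ : Circle) : (poissonKernel a ξ : ℂ) =
    (1 - conj (a : ℂ) * a) * (conj (szegoKernel a ξ) * szegoKernel a ξ) := by
  rw [poissonKernel, Complex.conj_mul', Complex.conj_mul']
  push_cast
  ring

theorem integral_poissonKernel_mul_pow (a : 𝔻) (k : ℕ) :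
    ∫ ξ, (poissonKernel a ξ : ℂ) * (blaschke a ξ : ℂ) ^ k ∂circleMeasure =
      if k = 0 then 1 else 0 := by
  simp only [coe_poissonKernel, mul_assoc]
  rw [integral_const_mul]
  rcases k with _ | k
  · simpa using norm_sq_integral_szegoKernel a
  · have h := (isAnalytic_one.szegoKernel_mul a).integral_conj_szegoKernel_mul a k
    rw [if_neg (Nat.succ_ne_zero k), ← mul_zero (1 - conj (a : ℂ) * a), ← h]
    congr 2
    ext ξ
    ring

theorem integral_poissonKernel_mul_zpow (a : 𝔻) (k : ℤ) :
    ∫ ξ, (poissonKernel a ξ : ℂ) * (blaschke a ξ : ℂ) ^ k ∂circleMeasure =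
      if k = 0 then 1 else 0 := by
  obtain ⟨m, rfl | rfl⟩ := k.eq_nat_or_neg
  · simpa using integral_poissonKernel_mul_pow a m
  · have h := congrArg conj (integral_poissonKernel_mul_pow a m)
    rw [← integral_conj] at h
    simp only [map_mul, Complex.conj_ofReal, map_pow, ← Circle.coe_inv_eq_conj] at h
    simp only [zpow_neg, zpow_natCast, neg_eq_zero, Nat.cast_eq_zero]
    simp only [Circle.coe_inv, inv_pow] at h
    rw [h]
    split_ifs <;> simp

/-- The trigonometric polynomials form a star subalgebra that separates points, and such a
subalgebra determines a finite measure. -/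
theorem ext_of_integral_fourier {T : ℝ} [Fact (0 < T)] {μ ν : Measure (AddCircle T)}
    [IsFiniteMeasure μ] [IsFiniteMeasure ν]
    (h : ∀ n : ℤ, ∫ t, fourier n t ∂μ = ∫ t, fourier n t ∂ν) : μ = ν := by
  refine ext_of_forall_mem_subalgebra_integral_eq_of_polish (𝕜 := ℂ)
    (A := (fourierSubalgebra (T := T)).comap (BoundedContinuousFunction.toContinuousMapStarₐ ℂ))
    ?_ ?_
  · intro x y hxy
    obtain ⟨_, ⟨u, hu, rfl⟩, hne⟩ := fourierSubalgebra_separatesPoints (T := T) hxy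
    exact ⟨_, ⟨u, ⟨BoundedContinuousFunction.mkOfCompact u, hu, rfl⟩, rfl⟩, hne⟩
  · intro g hg
    have hspan : g.toContinuousMap ∈ Submodule.span ℂ (Set.range (fourier (T := T))) := by
      rw [← fourierSubalgebra_coe]
      exact hg
    have key : ∀ u ∈ Submodule.span ℂ (Set.range (fourier (T := T))),
        ∫ t, u t ∂μ = ∫ t, u t ∂ν := by
      have hi (ρ : Measure (AddCircle T)) [IsFiniteMeasure ρ] (u : C(AddCircle T, ℂ)) :
          Integrable u ρ :=
        u.continuous.integrable_of_hasCompactSupport (HasCompactSupport.of_compactSpace _)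
      intro u hu
      induction hu using Submodule.span_induction with
      | mem u hu => obtain ⟨n, rfl⟩ := hu; exact h n
      | zero => simp
      | add u v _ _ hu hv =>
        simp only [ContinuousMap.add_apply]
        rw [integral_add (hi μ u) (hi μ v), integral_add (hi ν u) (hi ν v), hu, hv]
      | smul c u _ hu =>
        simp only [ContinuousMap.smul_apply]
        rw [integral_smul, integral_smul, hu]
    exact key _ hspan

theorem ext_of_integral_zpow {μ ν : Measure Circle} [IsFiniteMeasure μ] [IsFiniteMeasure ν]
    (h : ∀ n : ℤ, ∫ ξ, (ξ : ℂ) ^ n ∂μ = ∫ ξ, (ξ : ℂ) ^ n ∂ν) : μ = ν := by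
  let e : AddCircle (2 * Real.pi) ≃ᵐ Circle :=
    (AddCircle.homeomorphCircle Real.two_pi_pos.ne').toMeasurableEquiv
  have he : ∀ ξ, AddCircle.toCircle (e.symm ξ) = ξ := fun ξ => by
    have : e (e.symm ξ) = AddCircle.toCircle (e.symm ξ) :=
      AddCircle.homeomorphCircle_apply Real.two_pi_pos.ne' _
    rw [← this, e.apply_symm_apply]
  have key : μ.map e.symm = ν.map e.symm := by
    refine ext_of_integral_fourier fun n => ?_
    rw [integral_map_equiv, integral_map_equiv]
    simpa only [fourier_apply, AddCircle.toCircle_zsmul, he, Circle.coe_zpow] using h n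
  have hm := congrArg (Measure.map e) key
  simpa only [MeasurableEquiv.map_map_symm] using hm

/-- The harmonic measure on the circle of the point `a` of the disc. -/
def poissonMeasure (a : 𝔻) : Measure Circle :=
  circleMeasure.withDensity fun ξ => ENNReal.ofReal (poissonKernel a ξ)

theorem poissonMeasure_absolutelyContinuous (a : 𝔻) : poissonMeasure a ≪ circleMeasure :=
  withDensity_absolutelyContinuous _ _

theorem integral_poissonMeasure (a : 𝔻) (u : Circle → ℂ) :
    ∫ ξ, u ξ ∂poissonMeasure a = ∫ ξ, (poissonKernel a ξ : ℂ) * u ξ ∂circleMeasure := by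
  rw [poissonMeasure, integral_withDensity_eq_integral_toReal_smul
    (continuous_poissonKernel a).measurable.ennreal_ofReal
    (Eventually.of_forall fun _ => ENNReal.ofReal_lt_top)]
  refine integral_congr_ae (Eventually.of_forall fun ξ => ?_)
  simp only [ENNReal.toReal_ofReal (poissonKernel_nonneg a ξ), Complex.real_smul]

instance (a : 𝔻) : IsFiniteMeasure (poissonMeasure a) := by
  refine isFiniteMeasure_withDensity_ofReal ?_
  exact ((continuous_poissonKernel a).integrable_of_hasCompactSupport
    (HasCompactSupport.of_compactSpace _)).2

/-- Both measures have moments 1 at order 0 and 0 at every other order, so no Jacobian has to be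
computed. -/
theorem measurePreserving_blaschke (a : 𝔻) :
    MeasurePreserving (blaschke a) (poissonMeasure a) circleMeasure := by
  refine ⟨(continuous_blaschke a).measurable, ext_of_integral_zpow fun n => ?_⟩
  rw [integral_map (continuous_blaschke a).aemeasurable
    (continuous_coe_zpow n).aestronglyMeasurable, integral_poissonMeasure,
    integral_poissonKernel_mul_zpow]
  have h := circleCoeff_one (-n)
  simp only [circleCoeff, neg_neg, mul_one, neg_eq_zero] at h
  exact h.symm

theorem blaschke_neg_blaschke (a : 𝔻) (ξ : Circle) : blaschke (-a) (blaschke a ξ) = ξ := by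
  apply Circle.ext
  have h := szegoKernel_mul_one_sub (-a) (blaschke a ξ)
  have h1 := szegoKernel_mul_one_sub a ξ
  have h2 : (1 - conj (a : ℂ) * a) ≠ 0 := by
    rw [Complex.conj_mul']
    exact_mod_cast (one_sub_norm_sq_pos a).ne'
  rw [coe_blaschke]
  simp only [Complex.UnitDisc.coe_neg, map_neg] at h ⊢
  have h3 : 1 - -conj (a : ℂ) * blaschke a ξ = szegoKernel a ξ * (1 - conj (a : ℂ) * a) := by
    rw [coe_blaschke]
    linear_combination -h1
  have h4 : (blaschke a ξ : ℂ) - -a = ξ * (szegoKernel a ξ * (1 - conj (a : ℂ) * a)) := by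
    rw [coe_blaschke]
    linear_combination -a * h1
  rw [h3] at h
  rw [h4]
  linear_combination (ξ : ℂ) * h

/-- The Blaschke factor as an automorphism of the circle. -/
def blaschkeEquiv (a : 𝔻) : Circle ≃ᵐ Circle where
  toFun := blaschke a
  invFun := blaschke (-a)
  left_inv := blaschke_neg_blaschke a
  right_inv ξ := by simpa using blaschke_neg_blaschke (-a) ξ
  measurable_toFun := (continuous_blaschke a).measurable
  measurable_invFun := (continuous_blaschke (-a)).measurable

theorem measurePreserving_blaschke_neg (a : 𝔻) :
    MeasurePreserving (blaschke (-a)) circleMeasure (poissonMeasure a) :=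
  MeasurePreserving.symm (blaschkeEquiv a) (measurePreserving_blaschke a)

theorem aemeasurable_comp_blaschke_neg (a : 𝔻) {f : Circle → ℝ}
    (hf : AEMeasurable f circleMeasure) :
    AEMeasurable (fun ξ => f (blaschke (-a) ξ)) circleMeasure :=
  (hf.mono_ac (poissonMeasure_absolutelyContinuous a)).comp_quasiMeasurePreserving
    (measurePreserving_blaschke_neg a).quasiMeasurePreserving

/-- Valid for every `u`, measurable or not, because the Blaschke factor is a measurable automorphism
of the circle. -/
theorem integral_comp_blaschke_neg (a : 𝔻) (u : Circle → ℂ) :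
    ∫ ξ, u (blaschke (-a) ξ) ∂circleMeasure =
      ∫ ξ, (poissonKernel a ξ : ℂ) * u ξ ∂circleMeasure := by
  rw [← integral_poissonMeasure]
  exact (measurePreserving_blaschke_neg a).integral_comp
    (blaschkeEquiv a).symm.measurableEmbedding u

/-! ### The Takenaka–Malmquist basis of the model space -/

theorem isAnalytic_coeFn_iff {f : L2} : IsAnalytic f ↔ f ∈ hardy :=
  ⟨fun h => h.coeff, fun h => ⟨(Lp.memLp f).integrable one_le_two, h⟩⟩

theorem IsAnalytic.congr {f g : Circle → ℂ} (hf : IsAnalytic f) (h : f =ᵐ[circleMeasure] g) :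
    IsAnalytic g :=
  ⟨hf.integrable.congr h, fun n hn => by rw [← circleCoeff_congr_ae h, hf.coeff n hn]⟩

/-- The Takenaka–Malmquist functions `√(1 - |a|²) / (1 - conj a * ξ) * b_a(ξ) ^ k`. -/
def takenaka (a : 𝔻) (k : ℕ) : C(Circle, ℂ) where
  toFun ξ := Real.sqrt (1 - ‖(a : ℂ)‖ ^ 2) * ((blaschke a ξ : ℂ) ^ k * szegoKernel a ξ)
  continuous_toFun := continuous_const.mul
    (((continuous_circle_coe.comp (continuous_blaschke a)).pow k).mul (continuous_szegoKernel a))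

theorem takenaka_apply (a : 𝔻) (k : ℕ) (ξ : Circle) : takenaka a k ξ =
    Real.sqrt (1 - ‖(a : ℂ)‖ ^ 2) * ((blaschke a ξ : ℂ) ^ k * szegoKernel a ξ) := rfl

/-- The dependence on `k - j` alone gives both the orthonormality and the Toeplitz structure of the
compression. -/
theorem conj_takenaka_mul_takenaka (a : 𝔻) (j k : ℕ) (ξ : Circle) :
    conj (takenaka a j ξ) * takenaka a k ξ =
      poissonKernel a ξ * (blaschke a ξ : ℂ) ^ ((k : ℤ) - j) := by
  have h1 : (Real.sqrt (1 - ‖(a : ℂ)‖ ^ 2) : ℂ) * Real.sqrt (1 - ‖(a : ℂ)‖ ^ 2) =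
      1 - conj (a : ℂ) * a := by
    rw [← Complex.ofReal_mul, Real.mul_self_sqrt (one_sub_norm_sq_pos a).le, Complex.conj_mul']
    push_cast
    ring
  rw [takenaka_apply, takenaka_apply, coe_poissonKernel, ← h1,
    zpow_sub₀ (blaschke a ξ).coe_ne_zero, zpow_natCast, zpow_natCast]
  simp only [map_mul, map_pow, Complex.conj_ofReal]
  rw [← Circle.coe_inv_eq_conj, Circle.coe_inv, inv_pow]
  ring

theorem norm_takenaka_sq (a : 𝔻) (k : ℕ) (ξ : Circle) :
    ‖takenaka a k ξ‖ ^ 2 = poissonKernel a ξ := by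
  have h := conj_takenaka_mul_takenaka a k k ξ
  rw [sub_self, zpow_zero, mul_one, Complex.conj_mul'] at h
  exact_mod_cast h

theorem isAnalytic_takenaka (a : 𝔻) (k : ℕ) : IsAnalytic (takenaka a k) := by
  have h := ((isAnalytic_one.szegoKernel_mul a).blaschke_pow_mul a k).const_mul
    (Real.sqrt (1 - ‖(a : ℂ)‖ ^ 2))
  simp only [mul_one] at h
  exact h

/-- The Takenaka–Malmquist functions as elements of `L²`. -/
def takenakaLp (a : 𝔻) (k : ℕ) : L2 := (takenaka a k).toLp 2 circleMeasure ℂ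

theorem coeFn_takenakaLp (a : 𝔻) (k : ℕ) :
    (takenakaLp a k : Circle → ℂ) =ᵐ[circleMeasure] takenaka a k :=
  ContinuousMap.coeFn_toLp (p := 2) (𝕜 := ℂ) circleMeasure (takenaka a k)

theorem inner_eq_integral (f g : L2) :
    inner ℂ f g = ∫ ξ, conj (f ξ) * g ξ ∂circleMeasure := by
  rw [L2.inner_def]
  exact integral_congr_ae (Eventually.of_forall fun ξ => by simp [mul_comm])

theorem inner_takenakaLp (a : 𝔻) (k : ℕ) (f : L2) :
    inner ℂ (takenakaLp a k) f = ∫ ξ, conj (takenaka a k ξ) * f ξ ∂circleMeasure := by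
  rw [inner_eq_integral]
  refine integral_congr_ae ?_
  filter_upwards [coeFn_takenakaLp a k] with ξ hξ
  rw [hξ]

theorem orthonormal_takenakaLp (a : 𝔻) : Orthonormal ℂ (takenakaLp a) := by
  rw [orthonormal_iff_ite]
  intro j k
  rw [inner_takenakaLp]
  have : ∫ ξ, conj (takenaka a j ξ) * takenakaLp a k ξ ∂circleMeasure =
      ∫ ξ, poissonKernel a ξ * (blaschke a ξ : ℂ) ^ ((k : ℤ) - j) ∂circleMeasure := by
    refine integral_congr_ae ?_
    filter_upwards [coeFn_takenakaLp a k] with ξ hξ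
    rw [hξ, conj_takenaka_mul_takenaka]
  rw [this, integral_poissonKernel_mul_zpow]
  simp only [sub_eq_zero, Nat.cast_inj, eq_comm]

theorem takenakaLp_mem_hardyInf (a : 𝔻) (k : ℕ) : takenakaLp a k ∈ hardyInf := by
  refine ⟨isAnalytic_coeFn_iff.mp ((isAnalytic_takenaka a k).congr (coeFn_takenakaLp a k).symm),
    ?_⟩
  obtain ⟨C, hC⟩ := exists_norm_le_of_continuous (takenaka a k).continuous
  exact (memLp_top_of_bound (takenaka a k).continuous.aestronglyMeasurable C
    (Eventually.of_forall hC)).ae_eq (coeFn_takenakaLp a k).symm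

theorem coe_blaschke_pow (a : 𝔻) (n : ℕ) (ξ : Circle) :
    (((blaschke a ^ n) ξ : Circle) : ℂ) = (blaschke a ξ : ℂ) ^ n := by
  rw [Pi.pow_apply, Circle.coe_pow]

theorem takenakaLp_mem_modelSpace (a : 𝔻) {k n : ℕ} (hk : k < n) :
    takenakaLp a k ∈ modelSpace (blaschke a ^ n) := by
  refine ⟨(takenakaLp_mem_hardyInf a k).1, (Submodule.mem_orthogonal' _ _).mpr ?_⟩
  rintro u ⟨h, hh, hu⟩
  -- After cancelling `b^k` at least one Blaschke factor is left against the conjugated Szegő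
  -- kernel, so the integral vanishes.
  obtain ⟨m, rfl⟩ : ∃ m, n = k + (m + 1) := ⟨n - k - 1, by omega⟩
  have h0 := (isAnalytic_coeFn_iff.mpr hh).integral_conj_szegoKernel_mul a m
  rw [inner_takenakaLp, ← mul_zero (Real.sqrt (1 - ‖(a : ℂ)‖ ^ 2) : ℂ), ← h0,
    ← integral_const_mul]
  refine integral_congr_ae ?_
  filter_upwards [hu] with ξ hξ
  have hb : conj (blaschke a ξ : ℂ) ^ k * (blaschke a ξ : ℂ) ^ k = 1 := by
    rw [← mul_pow, conj_coe_mul_coe, one_pow]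
  rw [hξ, coe_blaschke_pow, takenaka_apply, pow_add]
  simp only [map_mul, map_pow, Complex.conj_ofReal]
  linear_combination (Real.sqrt (1 - ‖(a : ℂ)‖ ^ 2) * conj (szegoKernel a ξ) *
    (blaschke a ξ : ℂ) ^ (m + 1) * h ξ) * hb

/-- Orthogonality to the function of index `k` allows one more division by `b`. After `n` divisions
`g` lies in `b^n H²`, to which it is also orthogonal. -/
theorem eq_zero_of_mem_modelSpace (a : 𝔻) {n : ℕ} {g : L2}
    (hg : g ∈ modelSpace (blaschke a ^ n))
    (h : ∀ k < n, inner ℂ (takenakaLp a k) g = 0) : g = 0 := by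
  have key : ∀ k ≤ n, IsAnalytic fun ξ => conj (blaschke a ξ : ℂ) ^ k * g ξ := by
    intro k
    induction k with
    | zero => intro _; simpa using isAnalytic_coeFn_iff.mpr hg.1
    | succ k ih =>
      intro hk
      have h1 := (ih (by omega)).conj_blaschke_mul a ?_
      · convert h1 using 2 with ξ
        ring
      · have h2 := h k (by omega)
        rw [inner_takenakaLp] at h2
        have h3 : (Real.sqrt (1 - ‖(a : ℂ)‖ ^ 2) : ℂ) ≠ 0 :=
          Complex.ofReal_ne_zero.mpr (Real.sqrt_pos.mpr (one_sub_norm_sq_pos a)).ne'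
        refine (mul_eq_zero.mp ?_).resolve_left h3
        rw [← h2, ← integral_const_mul]
        refine integral_congr_ae (Eventually.of_forall fun ξ => ?_)
        simp only [takenaka_apply, map_mul, map_pow, Complex.conj_ofReal]
        ring
  have hmem : MemLp (fun ξ => conj (blaschke a ξ : ℂ) ^ n * g ξ) 2 circleMeasure := by
    refine (Lp.memLp g).of_le (key n le_rfl).integrable.1 (Eventually.of_forall fun ξ => ?_)
    rw [norm_mul, norm_pow, RCLike.norm_conj, Circle.norm_coe, one_pow, one_mul]
  have hgm : g ∈ mulHardy (blaschke a ^ n) := by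
    refine ⟨hmem.toLp _, isAnalytic_coeFn_iff.mp ((key n le_rfl).congr hmem.coeFn_toLp.symm), ?_⟩
    filter_upwards [hmem.coeFn_toLp] with ξ hξ
    have hb : conj (blaschke a ξ : ℂ) ^ n * (blaschke a ξ : ℂ) ^ n = 1 := by
      rw [← mul_pow, conj_coe_mul_coe, one_pow]
    rw [hξ, coe_blaschke_pow]
    linear_combination (-g ξ) * hb
  exact inner_self_eq_zero.mp ((Submodule.mem_orthogonal _ _).mp hg.2 g hgm)

/-- The Takenaka–Malmquist functions as elements of the model space of `b_a ^ n`. -/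
def takenakaModel (a : 𝔻) (n : ℕ) (k : Fin n) : modelSpace (blaschke a ^ n) :=
  ⟨takenakaLp a k, takenakaLp_mem_modelSpace a k.2⟩

theorem orthonormal_takenakaModel (a : 𝔻) (n : ℕ) : Orthonormal ℂ (takenakaModel a n) :=
  ((orthonormal_takenakaLp a).comp _ Fin.val_injective).codRestrict _ _

theorem orthogonal_span_takenakaModel (a : 𝔻) (n : ℕ) :
    (Submodule.span ℂ (Set.range (takenakaModel a n)))ᗮ = ⊥ := by
  rw [Submodule.eq_bot_iff]
  intro g hg
  refine Subtype.ext (eq_zero_of_mem_modelSpace a g.2 fun k hk => ?_)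
  exact (Submodule.mem_orthogonal _ _).mp hg _ (Submodule.subset_span ⟨⟨k, hk⟩, rfl⟩)

/-- The Takenaka–Malmquist basis of the model space of `b_a ^ n`. -/
def takenakaBasis (a : 𝔻) (n : ℕ) : OrthonormalBasis (Fin n) ℂ (modelSpace (blaschke a ^ n)) :=
  OrthonormalBasis.mkOfOrthogonalEqBot (orthonormal_takenakaModel a n)
    (orthogonal_span_takenakaModel a n)

theorem coe_takenakaBasis (a : 𝔻) (n : ℕ) (k : Fin n) :
    (takenakaBasis a n k : L2) = takenakaLp a k := by
  rw [takenakaBasis, OrthonormalBasis.coe_of_orthogonal_eq_bot_mk]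
  rfl

theorem finiteDimensional_modelSpace (a : 𝔻) (n : ℕ) :
    FiniteDimensional ℂ (modelSpace (blaschke a ^ n)) :=
  (takenakaBasis a n).toBasis.finiteDimensional_of_finite

theorem finrank_modelSpace (a : 𝔻) (n : ℕ) :
    Module.finrank ℂ (modelSpace (blaschke a ^ n)) = n := by
  rw [Module.finrank_eq_card_basis (takenakaBasis a n).toBasis, Fintype.card_fin]

theorem modelSpace_le_hardyInf (a : 𝔻) (n : ℕ) : modelSpace (blaschke a ^ n) ≤ hardyInf := by
  intro g hg
  have h := congrArg (modelSpace (blaschke a ^ n)).subtype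
    ((takenakaBasis a n).sum_repr ⟨g, hg⟩)
  rw [map_sum] at h
  rw [← show _ = g from h]
  refine Submodule.sum_mem _ fun k _ => ?_
  rw [map_smul, Submodule.subtype_apply, coe_takenakaBasis]
  exact hardyInf.smul_mem _ (takenakaLp_mem_hardyInf a k)

/-! ### The compression and its Toeplitz matrix -/

/-- Both projections disappear because `u` already lies in the model space, hence in `H²`. -/
theorem inner_compression (φ : L2) (θ : Circle → Circle) (hθ : modelSpace θ ≤ hardyInf)
    (u v : modelSpace θ) :
    inner ℂ u (compression φ θ hθ v) =
      ∫ ξ, conj ((u : L2) ξ) * (φ ξ * (v : L2) ξ) ∂circleMeasure := by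
  have hw := memLp_mul φ (Submodule.inclusion hθ v)
  have h : inner ℂ u (compression φ θ hθ v) = inner ℂ (u : L2) (hw.toLp _) := by
    change inner ℂ u ((modelSpace θ).orthogonalProjectionOnto
      (hardy.orthogonalProjectionOnto (hw.toLp _) : L2)) = _
    rw [Submodule.inner_orthogonalProjectionOnto_eq_of_mem_left]
    exact Submodule.inner_orthogonalProjectionOnto_eq_of_mem_left (K := hardy)
      ⟨(u : L2), u.2.1⟩ _
  rw [h, inner_eq_integral]
  refine integral_congr_ae ?_
  filter_upwards [hw.coeFn_toLp] with ξ hξ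
  rw [hξ]
  rfl

section Real

variable {f : Circle → ℝ} (hf : MemLp (fun ξ => (f ξ : ℂ)) 2 circleMeasure)
include hf

theorem inner_compression_real (θ : Circle → Circle) (hθ : modelSpace θ ≤ hardyInf)
    (u v : modelSpace θ) :
    inner ℂ u (compression (hf.toLp _) θ hθ v) =
      ∫ ξ, conj ((u : L2) ξ) * (f ξ * (v : L2) ξ) ∂circleMeasure := by
  rw [inner_compression]
  refine integral_congr_ae ?_
  filter_upwards [hf.coeFn_toLp] with ξ hξ
  rw [hξ]

theorem isSymmetric_compression (θ : Circle → Circle) (hθ : modelSpace θ ≤ hardyInf) :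
    (compression (hf.toLp _) θ hθ).IsSymmetric := by
  intro u v
  rw [← inner_conj_symm, inner_compression_real hf, inner_compression_real hf, ← integral_conj]
  refine integral_congr_ae (Eventually.of_forall fun ξ => ?_)
  simp only [map_mul, Complex.conj_conj, Complex.conj_ofReal]
  ring

theorem inner_takenakaBasis_compression (a : 𝔻) (n : ℕ)
    (hθ : modelSpace (blaschke a ^ n) ≤ hardyInf) (j k : Fin n) :
    inner ℂ (takenakaBasis a n j) (compression (hf.toLp _) _ hθ (takenakaBasis a n k)) =
      circleCoeff (fun ξ => (f (blaschke (-a) ξ) : ℂ)) ((j : ℤ) - k) := by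
  have h := integral_comp_blaschke_neg a
    (fun ξ => (blaschke a ξ : ℂ) ^ (-((j : ℤ) - k)) * (f ξ : ℂ))
  have hb : ∀ ξ, blaschke a (blaschke (-a) ξ) = ξ := (blaschkeEquiv a).apply_symm_apply
  simp only [hb] at h
  rw [circleCoeff, h, inner_compression_real hf]
  refine integral_congr_ae ?_
  filter_upwards [coeFn_takenakaLp a j, coeFn_takenakaLp a k] with ξ h1 h2
  rw [coe_takenakaBasis, coe_takenakaBasis, h1, h2, neg_sub]
  linear_combination (f ξ : ℂ) * conj_takenaka_mul_takenaka a j k ξ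

end Real

/-! ### Second moments of the eigenvalues -/

/-- The squared Hilbert–Schmidt norm, computed in an eigenbasis and in `e`. -/
theorem sum_sq_eigenvalues {E : Type*} [NormedAddCommGroup E] [InnerProductSpace ℂ E]
    [FiniteDimensional ℂ E] {T : E →ₗ[ℂ] E} (hT : T.IsSymmetric) {n : ℕ}
    (hn : Module.finrank ℂ E = n) (e : OrthonormalBasis (Fin n) ℂ E) :
    ∑ i, hT.eigenvalues hn i ^ 2 = ∑ k, ∑ j, ‖inner ℂ (e j) (T (e k))‖ ^ 2 := by
  have h : ∀ k i, ‖inner ℂ (hT.eigenvectorBasis hn i) (T (e k))‖ ^ 2 =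
      hT.eigenvalues hn i ^ 2 * ‖inner ℂ (hT.eigenvectorBasis hn i) (e k)‖ ^ 2 := by
    intro k i
    rw [← hT, hT.apply_eigenvectorBasis, inner_smul_left, norm_mul, mul_pow, RCLike.norm_conj]
    congr 1
    rw [RCLike.norm_ofReal, sq_abs]
  simp_rw [e.sum_sq_norm_inner_right, ← (hT.eigenvectorBasis hn).sum_sq_norm_inner_right, h]
  rw [Finset.sum_comm]
  simp_rw [← Finset.mul_sum, e.sum_sq_norm_inner_left, OrthonormalBasis.norm_eq_one]
  simp

theorem hasSum_sq_circleCoeff {h : Circle → ℂ} (hh : MemLp h 2 circleMeasure) :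
    HasSum (fun m => ‖circleCoeff h m‖ ^ 2) (∫ ξ, ‖h ξ‖ ^ 2 ∂circleMeasure) := by
  have hmp : MeasurePreserving (AddCircle.toCircle : AddCircle (2 * Real.pi) → Circle)
      AddCircle.haarAddCircle circleMeasure := ⟨AddCircle.continuous_toCircle.measurable, rfl⟩
  have hc := hh.comp_measurePreserving hmp
  have hs := hasSum_sq_fourierCoeff (hc.toLp _)
  have he := hc.coeFn_toLp
  have h1 : ∫ t, ‖hc.toLp _ t‖ ^ 2 ∂AddCircle.haarAddCircle = ∫ ξ, ‖h ξ‖ ^ 2 ∂circleMeasure := by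
    rw [← hmp.integral_comp ((AddCircle.continuous_toCircle (T := 2 * Real.pi)).isClosedEmbedding
      (AddCircle.injective_toCircle Real.two_pi_pos.ne')).measurableEmbedding]
    refine integral_congr_ae ?_
    filter_upwards [he] with t ht
    rw [ht]
    rfl
  rw [h1] at hs
  convert hs using 3 with m
  rw [circleCoeff_eq_fourierCoeff, fourierCoeff_congr_ae he]
  rfl

/-- Enlarging the matrix from size `n` to `n + 1` adds a row and a column whose entries are `c m`
for `-n ≤ m ≤ n`, once each. The double sum is thus a sum of symmetric partial sums of `c`, and its
mean is a Cesàro mean. -/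
theorem tendsto_mean_toeplitz_sum {c : ℤ → ℝ} {s : ℝ} (hc : HasSum c s) :
    Tendsto (fun n : ℕ => (n : ℝ)⁻¹ * ∑ k : Fin n, ∑ j : Fin n, c ((j : ℤ) - k)) atTop (𝓝 s) := by
  -- The paired sum covers `-n ≤ m ≤ n - 1`; the separate term `c n` completes the symmetric range
  -- and tends to zero.
  have hr : Tendsto (fun n : ℕ => (∑ j ∈ Finset.range n, (c j + c (-(j + 1)))) + c n)
      atTop (𝓝 (s + 0)) :=
    hc.nat_add_neg_add_one.tendsto_sum_nat.add
      ((hc.summable.comp_injective Nat.cast_injective).tendsto_atTop_zero)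
  rw [add_zero] at hr
  refine hr.cesaro.congr fun n => ?_
  congr 1
  rw [Finset.sum_range fun k => _]
  induction n with
  | zero => simp
  | succ n ih =>
    rw [Fin.sum_univ_castSucc, Fin.sum_univ_castSucc (n := n)
      (f := fun k => ∑ j : Fin (n + 1), c ((j : ℤ) - k))]
    simp only [Fin.sum_univ_castSucc (n := n), Finset.sum_add_distrib, Fin.val_castSucc,
      Fin.val_last] at ih ⊢
    rw [ih]
    have h1 : ∑ x : Fin n, c ((n : ℤ) - x) + c ((n : ℤ) - n) =
        ∑ j ∈ Finset.range n, c j + c n := by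
      rw [Fin.sum_univ_eq_sum_range (fun x => c ((n : ℤ) - x)) n,
        ← Finset.sum_range_succ (fun x => c ((n : ℤ) - x)) n,
        ← Finset.sum_range_succ (fun x => c x) n, ← Finset.sum_range_reflect (fun x => c x)]
      refine Finset.sum_congr rfl fun x hx => ?_
      rw [Finset.mem_range] at hx
      congr 1
      omega
    have h2 : ∑ x : Fin n, c ((x : ℤ) - n) = ∑ j ∈ Finset.range n, c (-((j : ℤ) + 1)) := by
      rw [Fin.sum_univ_eq_sum_range (fun x => c ((x : ℤ) - n)) n,
        ← Finset.sum_range_reflect (fun x => c (-((x : ℤ) + 1)))]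
      refine Finset.sum_congr rfl fun x hx => ?_
      rw [Finset.mem_range] at hx
      congr 1
      omega
    linarith

/-! ### The variance estimate -/

/-- If the densities `W i` add up to `card ι • p`, and `l i` is the mean of `f` with respect to
`W i`, then the sum of the values of a test function `H` at the `l i` is controlled by the sum of
the variances of `f` with respect to the `W i`. -/
theorem norm_sum_sub_integral_le {Ω ι : Type*} [MeasurableSpace Ω] [Fintype ι] {μ : Measure Ω}
    {f p : Ω → ℝ} {W : ι → Ω → ℝ} {l : ι → ℝ} {H : ℝ → ℂ} {M ε C : ℝ}
    (hW : ∀ i ξ, 0 ≤ W i ξ) (hsum : ∀ᵐ ξ ∂μ, ∑ i, W i ξ = Fintype.card ι * p ξ)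
    (hWi : ∀ i, Integrable (W i) μ) (hfW : ∀ i, Integrable (fun ξ => f ξ * W i ξ) μ)
    (hffW : ∀ i, Integrable (fun ξ => f ξ ^ 2 * W i ξ) μ)
    (hW1 : ∀ i, ∫ ξ, W i ξ ∂μ = 1) (hl : ∀ i, ∫ ξ, f ξ * W i ξ ∂μ = l i)
    (hHf : AEStronglyMeasurable (fun ξ => H (f ξ)) μ) (hM : ∀ x, ‖H x‖ ≤ M)
    (hH : ∀ x y, ‖H x - H y‖ ≤ ε + C * (x - y) ^ 2) :
    ‖∑ i, H (l i) - Fintype.card ι * ∫ ξ, (p ξ : ℂ) * H (f ξ) ∂μ‖ ≤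
      Fintype.card ι * ε + C * (Fintype.card ι * ∫ ξ, p ξ * f ξ ^ 2 ∂μ - ∑ i, l i ^ 2) := by
  have hHW : ∀ i, Integrable (fun ξ => H (f ξ) * W i ξ) μ := fun i =>
    (hWi i).ofReal.bdd_mul hHf (Eventually.of_forall fun ξ => hM (f ξ))
  have h1 : Fintype.card ι * ∫ ξ, (p ξ : ℂ) * H (f ξ) ∂μ =
      ∑ i, ∫ ξ, H (f ξ) * W i ξ ∂μ := by
    rw [← integral_finsetSum _ fun i _ => hHW i, ← integral_const_mul]
    refine integral_congr_ae ?_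
    filter_upwards [hsum] with ξ hξ
    rw [← Finset.mul_sum, ← Complex.ofReal_sum, hξ]
    push_cast
    ring
  have h2 : Fintype.card ι * ∫ ξ, p ξ * f ξ ^ 2 ∂μ = ∑ i, ∫ ξ, f ξ ^ 2 * W i ξ ∂μ := by
    rw [← integral_finsetSum _ fun i _ => hffW i, ← integral_const_mul]
    refine integral_congr_ae ?_
    filter_upwards [hsum] with ξ hξ
    rw [← Finset.mul_sum, hξ]
    ring
  have h3 : ∀ i, H (l i) - ∫ ξ, H (f ξ) * W i ξ ∂μ = ∫ ξ, (H (l i) - H (f ξ)) * W i ξ ∂μ := by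
    intro i
    have hWc : Integrable (fun ξ => H (l i) * (W i ξ : ℂ)) μ := (hWi i).ofReal.const_mul _
    have hc : ∫ ξ, (W i ξ : ℂ) ∂μ = 1 := by rw [integral_complex_ofReal, hW1, Complex.ofReal_one]
    simp only [sub_mul]
    rw [integral_sub hWc (hHW i), integral_const_mul, hc, mul_one]
  -- As `l i` is the mean of `f` under the probability density `W i`, the integral of `(l i - f)² W
  -- i` is the second moment minus `l i ^ 2`.
  have h4 : ∀ i, ‖∫ ξ, (H (l i) - H (f ξ)) * W i ξ ∂μ‖ ≤
      ε + C * (∫ ξ, f ξ ^ 2 * W i ξ ∂μ - l i ^ 2) := by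
    intro i
    have ha : Integrable (fun ξ => (ε + C * l i ^ 2) * W i ξ) μ := (hWi i).const_mul _
    have hb : Integrable (fun ξ => (2 * C * l i) * (f ξ * W i ξ)) μ := (hfW i).const_mul _
    have hc : Integrable (fun ξ => C * (f ξ ^ 2 * W i ξ)) μ := (hffW i).const_mul _
    have hab : Integrable (fun ξ => (ε + C * l i ^ 2) * W i ξ - (2 * C * l i) * (f ξ * W i ξ))
      μ := ha.sub hb
    have hint : Integrable (fun ξ => (ε + C * l i ^ 2) * W i ξ - (2 * C * l i) * (f ξ * W i ξ)
      + C * (f ξ ^ 2 * W i ξ)) μ := hab.add hc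
    refine (norm_integral_le_of_norm_le hint (Eventually.of_forall fun ξ => ?_)).trans_eq ?_
    · rw [norm_mul, Complex.norm_real, Real.norm_of_nonneg (hW i ξ)]
      refine (mul_le_mul_of_nonneg_right (hH _ _) (hW i ξ)).trans_eq ?_
      ring
    · rw [integral_add hab hc, integral_sub ha hb, integral_const_mul,
        integral_const_mul, integral_const_mul, hW1, hl]
      ring
  rw [h1, h2, ← Finset.sum_sub_distrib, ← Finset.sum_sub_distrib]
  simp only [h3]
  refine (norm_sum_le_of_le _ fun i _ => h4 i).trans_eq ?_
  rw [Finset.sum_add_distrib, ← Finset.mul_sum]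
  simp

/-- Uniform continuity gives `ε` for points closer than `δ`; for the others the trivial bound `2M`
is at most `2M (x - y)² / δ²`. -/
theorem exists_norm_sub_le_add_sq {H : ℝ → ℂ} (hH : UniformContinuous H) {M : ℝ}
    (hM : ∀ x, ‖H x‖ ≤ M) {ε : ℝ} (hε : 0 < ε) :
    ∃ C, 0 ≤ C ∧ ∀ x y, ‖H x - H y‖ ≤ ε + C * (x - y) ^ 2 := by
  obtain ⟨δ, hδ, h⟩ := Metric.uniformContinuous_iff.mp hH ε hε
  have hM0 : 0 ≤ M := (norm_nonneg _).trans (hM 0)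
  refine ⟨2 * M / δ ^ 2, by positivity, fun x y => ?_⟩
  by_cases hxy : dist x y < δ
  · have h1 := h hxy
    rw [dist_eq_norm] at h1
    have : 0 ≤ 2 * M / δ ^ 2 * (x - y) ^ 2 := by positivity
    linarith
  · have h1 : δ ^ 2 ≤ (x - y) ^ 2 := by
      rw [← sq_abs (x - y), ← Real.dist_eq]
      exact pow_le_pow_left₀ hδ.le (not_lt.mp hxy) 2
    have h2 : ‖H x - H y‖ ≤ 2 * M := (norm_sub_le _ _).trans (by linarith [hM x, hM y])
    have h3 : 2 * M ≤ 2 * M / δ ^ 2 * (x - y) ^ 2 := by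
      rw [div_mul_eq_mul_div, le_div_iff₀ (by positivity)]
      exact mul_le_mul_of_nonneg_left h1 (by positivity)
    linarith

/-- Parseval in both bases for the vector `K`. When `x k` is the value of `e k` at a point, `K` is
the reproducing kernel there. -/
theorem sum_norm_sq_sum_inner_mul {E ι : Type*} [NormedAddCommGroup E] [InnerProductSpace ℂ E]
    [Fintype ι] (e v : OrthonormalBasis ι ℂ E) (x : ι → ℂ) :
    ∑ i, ‖∑ k, inner ℂ (e k) (v i) * x k‖ ^ 2 = ∑ k, ‖x k‖ ^ 2 := by
  set K : E := ∑ k, conj (x k) • e k with hK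
  have h1 : ∀ i, ∑ k, inner ℂ (e k) (v i) * x k = inner ℂ K (v i) := by
    intro i
    rw [hK, sum_inner]
    refine Finset.sum_congr rfl fun k _ => ?_
    rw [inner_smul_left, Complex.conj_conj, mul_comm]
  have h2 : ∀ k, inner ℂ (e k) K = conj (x k) := e.orthonormal.inner_right_fintype _
  simp only [h1]
  rw [v.sum_sq_norm_inner_left, ← e.sum_sq_norm_inner_right]
  simp only [h2, RCLike.norm_conj]

/-- The sum of the squared moduli of the members of an orthonormal basis of the model space does
not depend on the basis. -/
theorem sum_norm_sq_orthonormalBasis (a : 𝔻) (n : ℕ)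
    (v : OrthonormalBasis (Fin n) ℂ (modelSpace (blaschke a ^ n))) :
    ∀ᵐ ξ ∂circleMeasure, ∑ i, ‖(v i : L2) ξ‖ ^ 2 = n * poissonKernel a ξ := by
  set e := takenakaBasis a n
  have hexp : ∀ i, (v i : L2) = ∑ k : Fin n, inner ℂ (e k) (v i) • takenakaLp a k := by
    intro i
    have h := congrArg (modelSpace (blaschke a ^ n)).subtype (e.sum_repr' (v i))
    simpa only [map_sum, map_smul, Submodule.subtype_apply, e, coe_takenakaBasis] using h.symm
  -- Members of `L²` are classes, so pointwise values of all the `v i` are fixed simultaneously off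
  -- one null set.
  have hae : ∀ᵐ ξ ∂circleMeasure, ∀ i, (v i : L2) ξ =
      ∑ k : Fin n, inner ℂ (e k) (v i) * takenaka a k ξ := by
    rw [eventually_countable_forall]
    intro i
    have h1 := Lp.coeFn_finsetSum Finset.univ
      (fun k : Fin n => inner ℂ (e k) (v i) • takenakaLp a k)
    rw [← hexp i] at h1
    have h2 : ∀ᵐ ξ ∂circleMeasure, ∀ k : Fin n, (inner ℂ (e k) (v i) • takenakaLp a k : L2) ξ =
        inner ℂ (e k) (v i) * takenaka a k ξ := by
      rw [eventually_countable_forall]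
      intro k
      filter_upwards [Lp.coeFn_smul (inner ℂ (e k) (v i)) (takenakaLp a k),
        coeFn_takenakaLp a k] with ξ h3 h4
      rw [h3, Pi.smul_apply, h4, smul_eq_mul]
    filter_upwards [h1, h2] with ξ h3 h4
    rw [h3, Finset.sum_apply]
    exact Finset.sum_congr rfl fun k _ => h4 k
  filter_upwards [hae] with ξ hξ
  simp only [hξ]
  rw [sum_norm_sq_sum_inner_mul e v fun k => takenaka a k ξ]
  simp only [norm_takenaka_sq]
  simp

/-! ### Limit distribution of the eigenvalues -/

section Real

variable {f : Circle → ℝ} (hf : MemLp (fun ξ => (f ξ : ℂ)) 2 circleMeasure)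
include hf

theorem memLp_real : MemLp f 2 circleMeasure := by
  simpa using hf.re

/-- The eigenvalues of the compression of `T_f` to the model space of `b_a ^ n`. -/
def compressionEigenvalues (a : 𝔻) (n : ℕ) : Fin n → ℝ :=
  haveI := finiteDimensional_modelSpace a n
  (isSymmetric_compression hf _ (modelSpace_le_hardyInf a n)).eigenvalues (finrank_modelSpace a n)

theorem tendsto_mean_sq_compressionEigenvalues (a : 𝔻) :
    Tendsto (fun n : ℕ => (n : ℝ)⁻¹ * ∑ i, compressionEigenvalues hf a n i ^ 2) atTop
      (𝓝 (∫ ξ, poissonKernel a ξ * f ξ ^ 2 ∂circleMeasure)) := by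
  have hmem : MemLp (fun ξ => (f (blaschke (-a) ξ) : ℂ)) 2 circleMeasure := by
    obtain ⟨c, hc⟩ := exists_norm_le_of_continuous
      (Complex.continuous_ofReal.comp (continuous_poissonKernel a))
    -- Boundedness of the Poisson kernel keeps `f ∘ b_{-a}` square integrable.
    have h1 : poissonMeasure a ≤ ENNReal.ofReal c • circleMeasure := by
      refine (withDensity_mono (Eventually.of_forall fun ξ => ?_)).trans_eq
        (withDensity_const _)
      refine ENNReal.ofReal_le_ofReal ((le_abs_self _).trans ?_)
      simpa using hc ξ
    exact ((hf.smul_measure ENNReal.ofReal_ne_top).mono_measure h1).comp_measurePreserving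
      (measurePreserving_blaschke_neg a)
  have hs := hasSum_sq_circleCoeff hmem
  have hint : ∫ ξ, ‖(f (blaschke (-a) ξ) : ℂ)‖ ^ 2 ∂circleMeasure =
      ∫ ξ, poissonKernel a ξ * f ξ ^ 2 ∂circleMeasure := by
    have h := integral_comp_blaschke_neg a (fun ξ => ((f ξ ^ 2 : ℝ) : ℂ))
    simp only [← Complex.ofReal_mul] at h
    rw [integral_complex_ofReal, integral_complex_ofReal] at h
    simpa using Complex.ofReal_injective h
  rw [hint] at hs
  refine (tendsto_mean_toeplitz_sum hs).congr fun n => ?_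
  have := finiteDimensional_modelSpace a n
  rw [compressionEigenvalues, sum_sq_eigenvalues _ _ (takenakaBasis a n)]
  simp only [inner_takenakaBasis_compression hf]

theorem norm_sum_compressionEigenvalues_sub_le (a : 𝔻) (n : ℕ) {H : ℝ → ℂ} (hHc : Continuous H)
    {M ε C : ℝ} (hM : ∀ x, ‖H x‖ ≤ M) (hH : ∀ x y, ‖H x - H y‖ ≤ ε + C * (x - y) ^ 2) :
    ‖∑ i, H (compressionEigenvalues hf a n i) -
        n * ∫ ξ, (poissonKernel a ξ : ℂ) * H (f ξ) ∂circleMeasure‖ ≤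
      n * ε + C * (n * ∫ ξ, poissonKernel a ξ * f ξ ^ 2 ∂circleMeasure -
        ∑ i, compressionEigenvalues hf a n i ^ 2) := by
  have := finiteDimensional_modelSpace a n
  have hT := isSymmetric_compression hf _ (modelSpace_le_hardyInf a n)
  have hn := finrank_modelSpace a n
  set v := hT.eigenvectorBasis hn with hv
  have hsum := sum_norm_sq_orthonormalBasis a n v
  have hfr := memLp_real hf
  obtain ⟨c, hc⟩ := exists_norm_le_of_continuous
    (Complex.continuous_ofReal.comp (continuous_poissonKernel a))
  have hvm : ∀ i, AEStronglyMeasurable (fun ξ => ‖(v i : L2) ξ‖ ^ 2) circleMeasure :=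
    fun i => (Lp.aestronglyMeasurable (v i : L2)).norm.pow 2
  -- Each density is at most `n P_a`, hence bounded, so `f²` times it is integrable although `f` is
  -- only in `L²`.
  have hbd : ∀ i, ∀ᵐ ξ ∂circleMeasure, ‖‖(v i : L2) ξ‖ ^ 2‖ ≤ n * c := by
    intro i
    filter_upwards [hsum] with ξ hξ
    rw [Real.norm_of_nonneg (by positivity)]
    have h1 : ‖(v i : L2) ξ‖ ^ 2 ≤ ∑ i, ‖(v i : L2) ξ‖ ^ 2 :=
      Finset.single_le_sum (f := fun i => ‖(v i : L2) ξ‖ ^ 2) (fun i _ => by positivity)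
        (Finset.mem_univ i)
    have h2 : poissonKernel a ξ ≤ c := by
      have := hc ξ
      rw [Function.comp_apply, Complex.norm_real] at this
      exact (le_abs_self _).trans this
    rw [hξ] at h1
    exact h1.trans (by gcongr)
  have hf1 : Integrable f circleMeasure := hfr.integrable one_le_two
  have hf2 : Integrable (fun ξ => f ξ ^ 2) circleMeasure := hfr.integrable_sq
  have hw0 : ∀ i, Integrable (fun ξ => ‖(v i : L2) ξ‖ ^ 2) circleMeasure :=
    fun i => Integrable.of_bound (hvm i) _ (hbd i)
  have hw1 : ∀ i, Integrable (fun ξ => f ξ * ‖(v i : L2) ξ‖ ^ 2) circleMeasure :=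
    fun i => hf1.mul_bdd (hvm i) (hbd i)
  have hw2 : ∀ i, Integrable (fun ξ => f ξ ^ 2 * ‖(v i : L2) ξ‖ ^ 2) circleMeasure :=
    fun i => hf2.mul_bdd (hvm i) (hbd i)
  have hm0 : ∀ i, ∫ ξ, ‖(v i : L2) ξ‖ ^ 2 ∂circleMeasure = 1 := by
    intro i
    have h1 : inner ℂ (v i) (v i) = (1 : ℂ) := v.inner_eq_one i
    rw [Submodule.coe_inner, inner_eq_integral] at h1
    simp only [Complex.conj_mul', ← Complex.ofReal_pow] at h1
    rw [integral_complex_ofReal] at h1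
    exact_mod_cast h1
  have hm1 : ∀ i, ∫ ξ, f ξ * ‖(v i : L2) ξ‖ ^ 2 ∂circleMeasure =
      compressionEigenvalues hf a n i := by
    intro i
    have h1 := inner_compression_real hf _ (modelSpace_le_hardyInf a n) (v i) (v i)
    rw [hv, hT.apply_eigenvectorBasis, inner_smul_right, OrthonormalBasis.inner_eq_one] at h1
    have h2 : ∀ ξ, conj ((v i : L2) ξ) * (f ξ * (v i : L2) ξ) =
        ((f ξ * ‖(v i : L2) ξ‖ ^ 2 : ℝ) : ℂ) := by
      intro ξ
      push_cast
      rw [← Complex.conj_mul']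
      ring
    rw [← hv] at h1
    simp only [h2] at h1
    rw [integral_complex_ofReal] at h1
    simp only [mul_one] at h1
    exact (Complex.ofReal_injective h1).symm
  have := norm_sum_sub_integral_le (μ := circleMeasure) (p := poissonKernel a)
    (W := fun i ξ => ‖(v i : L2) ξ‖ ^ 2) (l := compressionEigenvalues hf a n) (f := f)
    (fun i ξ => by positivity) (by simpa using hsum) hw0 hw1 hw2 hm0 hm1
    (hHc.comp_aestronglyMeasurable hfr.1) hM hH
  simpa using this

/-- After division by `n` the total variance tends to zero, and `ε` is arbitrary. -/
theorem tendsto_mean_compressionEigenvalues (a : 𝔻) {H : ℝ → ℂ} (hHu : UniformContinuous H)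
    {M : ℝ} (hM : ∀ x, ‖H x‖ ≤ M) :
    Tendsto (fun n : ℕ => (n : ℂ)⁻¹ * ∑ i, H (compressionEigenvalues hf a n i)) atTop
      (𝓝 (∫ ξ, H (f (blaschke (-a) ξ)) ∂circleMeasure)) := by
  rw [integral_comp_blaschke_neg a fun ξ => H (f ξ), Metric.tendsto_atTop']
  intro ε hε
  obtain ⟨C, hC0, hC⟩ := exists_norm_sub_le_add_sq hHu hM (half_pos hε)
  have hlim := ((tendsto_mean_sq_compressionEigenvalues hf a).const_sub
    (∫ ξ, poissonKernel a ξ * f ξ ^ 2 ∂circleMeasure)).const_mul C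
  rw [sub_self, mul_zero] at hlim
  obtain ⟨N, hN⟩ := eventually_atTop.mp (hlim.eventually_lt_const (half_pos hε))
  refine ⟨N, fun n hn => ?_⟩
  -- `n` exceeds `N` strictly, which excludes `n = 0`, where the inverse is 0 by convention.
  have hn0 : 0 < n := by omega
  have hnr : (0 : ℝ) < n := by exact_mod_cast hn0
  have hnc : (n : ℂ) ≠ 0 := by exact_mod_cast hn0.ne'
  have h1 := norm_sum_compressionEigenvalues_sub_le hf a n hHu.continuous hM hC
  have h2 := hN n hn.le
  rw [dist_eq_norm]
  set I := ∫ ξ, (poissonKernel a ξ : ℂ) * H (f ξ) ∂circleMeasure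
  set S := ∑ i, H (compressionEigenvalues hf a n i)
  have h3 : (n : ℂ)⁻¹ * S - I = (n : ℂ)⁻¹ * (S - n * I) := by
    field_simp
  rw [h3, norm_mul, norm_inv, Complex.norm_natCast]
  refine (mul_le_mul_of_nonneg_left h1 (by positivity)).trans_lt ?_
  have h4 : ∀ J Q : ℝ, (n : ℝ)⁻¹ * (n * (ε / 2) + C * (n * J - Q)) =
      ε / 2 + C * (J - (n : ℝ)⁻¹ * Q) := by
    intro J Q
    field_simp
  rw [h4]
  linarith

end Real

/-! ### Singular values of symmetric operators and conclusion -/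

theorem roots_charpoly_of_eigenbasis {E : Type*} [AddCommGroup E] [Module ℂ E] {n : ℕ}
    (v : Module.Basis (Fin n) ℂ E) {T : E →ₗ[ℂ] E} {c : Fin n → ℂ} (h : ∀ i, T (v i) = c i • v i) :
    haveI := v.finiteDimensional_of_finite
    T.charpoly.roots = Finset.univ.val.map c := by
  have := v.finiteDimensional_of_finite
  have hm : LinearMap.toMatrix v v T = Matrix.diagonal c := by
    ext i j
    rw [LinearMap.toMatrix_apply, h, map_smul, v.repr_self, Finsupp.smul_apply,
      Finsupp.single_apply, Matrix.diagonal_apply, smul_eq_mul]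
    by_cases hij : i = j
    · simp [hij]
    · rw [if_neg hij, if_neg (Ne.symm hij), mul_zero]
  rw [← LinearMap.charpoly_toMatrix T v, hm, Matrix.charpoly_diagonal]
  have hr := Polynomial.roots_multiset_prod_X_sub_C (Finset.univ.val.map c)
  rwa [Multiset.map_map] at hr

/-- The singular values of a symmetric operator are the absolute values of its eigenvalues. -/
theorem map_singularValues_of_isSymmetric {E : Type*} [NormedAddCommGroup E]
    [InnerProductSpace ℂ E] [FiniteDimensional ℂ E] {T : E →ₗ[ℂ] E} (hT : T.IsSymmetric) {n : ℕ}
    (hn : Module.finrank ℂ E = n) :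
    (Finset.univ : Finset (Fin n)).val.map (fun i : Fin n => T.singularValues i) =
      Finset.univ.val.map fun i => |hT.eigenvalues hn i| := by
  have hadj : LinearMap.adjoint T = T := (LinearMap.isSymmetric_iff_isSelfAdjoint T).mp hT
  -- `T* T = T²` has eigenvalues `λ_i²` in the eigenbasis of `T`. Singular values are ordered by
  -- size and the `|λ_i|` need not be, so the comparison is between multisets of characteristic
  -- roots.
  have h1 := roots_charpoly_of_eigenbasis (hT.eigenvectorBasis hn).toBasis
    (T := LinearMap.adjoint T ∘ₗ T) (c := fun i => ((hT.eigenvalues hn i ^ 2 : ℝ) : ℂ)) (by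
      intro i
      rw [hadj, OrthonormalBasis.coe_toBasis, LinearMap.comp_apply, hT.apply_eigenvectorBasis,
        map_smul, hT.apply_eigenvectorBasis, smul_smul]
      congr 1
      push_cast
      exact (sq _).symm)
  have h2 := T.isSymmetric_adjoint_comp_self.roots_charpoly_eq_eigenvalues hn
  have h3 := congrArg (Multiset.map fun z : ℂ => √z.re) (h2.symm.trans h1)
  simp only [Multiset.map_map, Function.comp_def, Complex.ofReal_re,
    Real.sqrt_sq_eq_abs] at h3
  rw [← h3]
  refine Multiset.map_congr rfl fun i _ => ?_
  rw [T.singularValues_fin hn]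
  rfl

end ModelSpaces

end

theorem theorem14 (a : Complex.UnitDisc) (f : Circle → ℝ)
    (hf : MemLp (fun ξ => (f ξ : ℂ)) 2 ModelSpaces.circleMeasure) :
    ModelSpaces.IsDistributedEigenvalues (hf.toLp (fun ξ => (f ξ : ℂ)))
        (fun ξ => (f (ModelSpaces.blaschke (-a) ξ) : ℂ)) (ModelSpaces.blaschke a) ∧
      ModelSpaces.IsDistributedSingularValues (hf.toLp (fun ξ => (f ξ : ℂ)))
        (fun ξ => |f (ModelSpaces.blaschke (-a) ξ)|) (ModelSpaces.blaschke a) := by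
  have hm := ModelSpaces.aemeasurable_comp_blaschke_neg a (ModelSpaces.memLp_real hf).1.aemeasurable
  have hfd := ModelSpaces.finiteDimensional_modelSpace a
  have hle := ModelSpaces.modelSpace_le_hardyInf a
  have hfr := ModelSpaces.finrank_modelSpace a
  refine ⟨⟨Complex.measurable_ofReal.comp_aemeasurable hm, hfd, hle, fun G hG hGc => ?_⟩,
    ⟨hm.abs, hfd, hle, fun G hG hGc => ?_⟩⟩
  · obtain ⟨M, hM⟩ := hG.bounded_above_of_compact_support hGc
    refine (ModelSpaces.tendsto_mean_compressionEigenvalues hf a (H := fun x : ℝ => G x)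
      ((hGc.uniformContinuous_of_continuous hG).comp
        Complex.isometry_ofReal.uniformContinuous) (fun x => hM x)).congr fun n => ?_
    have := hfd n
    rw [hfr n, (ModelSpaces.isSymmetric_compression hf _ (hle n)).roots_charpoly_eq_eigenvalues
      (hfr n), Multiset.map_map]
    rfl
  · obtain ⟨M, hM⟩ := hG.bounded_above_of_compact_support hGc
    refine (ModelSpaces.tendsto_mean_compressionEigenvalues hf a (H := fun x : ℝ => G |x|)
      ((hGc.uniformContinuous_of_continuous hG).comp
        uniformContinuous_norm) (fun x => hM _)).congr fun n => ?_
    have := hfd n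
    have h := congrArg (fun s => (Multiset.map G s).sum)
      (ModelSpaces.map_singularValues_of_isSymmetric
        (ModelSpaces.isSymmetric_compression hf _ (hle n)) (hfr n))
    simp only [Multiset.map_map] at h
    rw [hfr n, Finset.sum_range]
    congr 1
    exact h.symm
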